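/- Let $\Sigma$ be a finite alphabet. For an MSO-formula $\varphi(x_1,\dots,x_m)$ over words on $\Sigma$ (with the order on positions and the letter predicates) whose free variables are the first-order variables $x_1,\dots,x_m$, and for a word $w \in \Sigma^*$, let $\#\varphi(w)$ be the number of valuations of $(x_1,\dots,x_m)$ by positions of $w$ that satisfy $\varphi$ in $w$. For $k \ge 0$, let $\mathbb{N}\mathsf{Poly}_k$ be the set of functions $f \colon \Sigma^* \to \mathbb{Z}$ of the form $f = \sum_{i=1}^{n} c_i \cdot \#\varphi_i$ with $n \ge 0$, $c_i \in \mathbb{N}$, and each $\varphi_i$ an MSO-formula with at most $k$ free variables, all of them first-order; and let $\mathbb{N}\mathsf{Poly}_{-1} = \{0\}$. For $f \colon \Sigma^* \to \mathbb{Z}$ and $k \in \mathbb{N}$, define a relation $\sqsubseteq_f^k$ on $\Sigma^*$ by: $u \sqsubseteq_f^k v$ if and only if the function $w \mapsto f(vw) - f(uw)$ belongs to $\mathbb{N}\mathsf{Poly}_{k-1}$. Let $k \in \mathbb{N}$ and $f \in \mathbb{N}\mathsf{Poly}_k$. Then $\sqsubseteq_f^k$ is a well-quasi-ordering of $\Sigma^*$: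 it is reflexive and transitive, and for every infinite sequence $(u_i)_{i \in \mathbb{N}}$ of words there exist $i < j$ such that $u_i \sqsubseteq_f^k u_j$. -/

import Mathlib

/-- Formulas of monadic second-order logic over words on the alphabet `α`, whose free variables
are among the `m` first-order variables indexed by `Fin m` (ranging over positions) and the `n`
set variables indexed by `Fin n` (ranging over sets of positions). A quantifier binds the variable
with index `0` of its body. The remaining connectives and quantifiers are the usual
abbreviations. -/
inductive MSOFormula (α : Type*) : ℕ → ℕ → Type _
  /-- `a(x)`: the position `x` carries the letter `a`. -/
  | letter {m n : ℕ} (a : α) (x : Fin m) : MSOFormula α m n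
  /-- `x < y` -/
  | lt {m n : ℕ} (x y : Fin m) : MSOFormula α m n
  /-- `x = y` -/
  | eq {m n : ℕ} (x y : Fin m) : MSOFormula α m n
  /-- `x ∈ X` -/
  | mem {m n : ℕ} (x : Fin m) (X : Fin n) : MSOFormula α m n
  /-- Negation. -/
  | neg {m n : ℕ} (φ : MSOFormula α m n) : MSOFormula α m n
  /-- Conjunction. -/
  | conj {m n : ℕ} (φ ψ : MSOFormula α m n) : MSOFormula α m n
  /-- Existential quantification over a position. -/
  | exPos {m n : ℕ} (φ : MSOFormula α (m + 1) n) : MSOFormula α m n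
  /-- Existential quantification over a set of positions. -/
  | exSet {m n : ℕ} (φ : MSOFormula α m (n + 1)) : MSOFormula α m n

namespace MSOFormula

/-- `φ.Sat w x X`: the word `w` satisfies `φ` under the valuation `x` of the first-order
variables and the valuation `X` of the set variables. -/
def Sat {α : Type*} (w : List α) : {m n : ℕ} → MSOFormula α m n →
    (Fin m → Fin w.length) → (Fin n → Set (Fin w.length)) → Prop
  | _, _, letter a i, x, _ => w.get (x i) = a
  | _, _, lt i j, x, _ => x i < x j
  | _, _, eq i j, x, _ => x i = x j
  | _, _, mem i j, x, X => x i ∈ X j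
  | _, _, neg φ, x, X => ¬ φ.Sat w x X
  | _, _, conj φ ψ, x, X => φ.Sat w x X ∧ ψ.Sat w x X
  | m, _, exPos φ, x, X =>
      ∃ p : Fin w.length, φ.Sat w (Fin.cons p x : Fin (m + 1) → Fin w.length) X
  | _, n, exSet φ, x, X =>
      ∃ P : Set (Fin w.length), φ.Sat w x (Fin.cons P X : Fin (n + 1) → Set (Fin w.length))

/-- `#φ(w)`: the number of valuations of the free first-order variables `x₁, …, xₘ` that satisfy
`φ(x₁, …, xₘ)` in the word `w`. -/
noncomputable def count {α : Type*} {m : ℕ} (φ : MSOFormula α m 0) (w : List α) : ℕ :=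
  Nat.card {x : Fin m → Fin w.length // φ.Sat w x (fun i => Fin.elim0 i)}

end MSOFormula

/-- `f : α* → S` is a finite `S`-linear combination of functions `#φ`, where each `φ` is an
MSO-formula with at most `k` free variables, all of them first-order. The bound `k` is an integer:
for `k < 0` no formula qualifies, so only the empty sum, i.e. the function `0`, remains. -/
def IsPolyregular {α : Type*} (S : Type*) [CommSemiring S] (k : ℤ) (f : List α → S) : Prop :=
  ∃ (r : ℕ) (m : Fin r → ℕ) (φ : (i : Fin r) → MSOFormula α (m i) 0) (c : Fin r → S),
    (∀ i, (m i : ℤ) ≤ k) ∧ ∀ w : List α, f w = ∑ i, c i * ((φ i).count w : S)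

/-- `NPoly[k]`: the `ℕ`-polyregular functions given by formulas with at most `k` free variables,
seen as functions with values in `ℤ`. -/
def NPoly (α : Type*) (k : ℤ) : Set (List α → ℤ) :=
  {f | ∃ g : List α → ℕ, IsPolyregular ℕ k g ∧ ∀ w, f w = (g w : ℤ)}

/-- The residual of `f` at `u`, i.e. the function `w ↦ f (uw)`. -/
def wordResidual {α : Type*} (f : List α → ℤ) (u : List α) : List α → ℤ :=
  fun w => f (u ++ w)

/-- The noncommutative derivative of `f` at `u`, `v`: the residual of `f` at `u` minus the
residual of `f` at `v`. -/
def noncommDeriv {α : Type*} (f : List α → ℤ) (u v : List α) : List α → ℤ :=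
  wordResidual f u - wordResidual f v

/-- The residual quasi-order: `u` is below `v` if and only if the residual of `f` at `v` minus the
residual of `f` at `u` belongs to `NPoly[k-1]`, where `NPoly[-1] = {0}`. -/
def ResLE {α : Type*} (f : List α → ℤ) (k : ℕ) (u v : List α) : Prop :=
  noncommDeriv f v u ∈ NPoly α ((k : ℤ) - 1)

/-! Everything rests on one decomposition: `g (v ++ w) = ∑ t, a t v * (R t).count w`, with finitely
many terms chosen independently of `v` and `w`. The composition theorem `splits` separates a formula
on `v ++ w` into arbitrary properties of `v` and formulas on `w`; summing over which variables fall
in `v` gives the decomposition (`exists_count_append`). A term whose `R t` keeps all `k` variables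
leaves none for `v`, so its coefficient `a t` is bounded. By Dickson's lemma, some `i < j` in any
sequence of words make every coefficient nondecreasing from `u i` to `u j`. For the bounded ones,
the complement to the bound is compared too, which forces equality. The terms with `k` variables
then cancel in the difference of residuals, and the rest have natural coefficients and fewer than
`k` variables. -/

open Finset

/-! ### Finite conjunctions and truth sets -/

namespace MSOFormula

variable {α : Type*}

/-- The formula that always holds. -/
def verum {m n : ℕ} : MSOFormula α m n := neg (exPos (neg (eq 0 0)))

theorem sat_verum {m n : ℕ} (w : List α) (x : Fin m → Fin w.length)
    (X : Fin n → Set (Fin w.length)) : (verum : MSOFormula α m n).Sat w x X := by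
  simp [verum, Sat]

/-- The conjunction of a list of formulas. -/
def listConj {m n : ℕ} : List (MSOFormula α m n) → MSOFormula α m n
  | [] => verum
  | φ :: l => conj φ (listConj l)

theorem sat_listConj {m n : ℕ} (l : List (MSOFormula α m n)) (w : List α)
    (x : Fin m → Fin w.length) (X : Fin n → Set (Fin w.length)) :
    (listConj l).Sat w x X ↔ ∀ φ ∈ l, φ.Sat w x X := by
  induction l with
  | nil => simp [listConj, sat_verum]
  | cons φ l ih => simp [listConj, Sat, ih]

/-- The conjunction of a finite family of formulas. -/
noncomputable def finsetConj {ι : Type*} {m n : ℕ} (s : Finset ι) (R : ι → MSOFormula α m n) :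
    MSOFormula α m n :=
  listConj (s.toList.map R)

theorem sat_finsetConj {ι : Type*} {m n : ℕ} (s : Finset ι) (R : ι → MSOFormula α m n)
    (w : List α) (x : Fin m → Fin w.length) (X : Fin n → Set (Fin w.length)) :
    (finsetConj s R).Sat w x X ↔ ∀ i ∈ s, (R i).Sat w x X := by
  simp [finsetConj, sat_listConj]

/-- The formula saying that `T` is exactly the set of indices `i` for which `R i` holds. -/
noncomputable def truthSet {ι : Type*} [Fintype ι] [DecidableEq ι] {m n : ℕ}
    (R : ι → MSOFormula α m n) (T : Finset ι) : MSOFormula α m n :=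
  conj (finsetConj T R) (finsetConj Tᶜ fun i => neg (R i))

theorem sat_truthSet {ι : Type*} [Fintype ι] [DecidableEq ι] {m n : ℕ}
    (R : ι → MSOFormula α m n) (T : Finset ι)
    (w : List α) (x : Fin m → Fin w.length) (X : Fin n → Set (Fin w.length)) :
    (truthSet R T).Sat w x X ↔ ∀ i, i ∈ T ↔ (R i).Sat w x X := by
  simp only [truthSet, Sat, sat_finsetConj, mem_compl]
  constructor
  · rintro ⟨h1, h2⟩ i
    exact ⟨h1 i, fun h => by_contra fun hi => h2 i hi h⟩
  · intro h
    exact ⟨fun i => (h i).1, fun i hi hR => hi ((h i).2 hR)⟩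

end MSOFormula

/-! ### Positions of a concatenation -/

/-- The positions of `v ++ w` are the positions of `v` followed by those of `w`. -/
def appendEquiv {α : Type*} (v w : List α) :
    Fin v.length ⊕ Fin w.length ≃ Fin (v ++ w).length :=
  finSumFinEquiv.trans (finCongr List.length_append.symm)

section appendEquiv

variable {α : Type*} (v w : List α)

theorem appendEquiv_inl_val (i : Fin v.length) : (appendEquiv v w (.inl i)).val = i := by
  simp [appendEquiv]

theorem appendEquiv_inr_val (i : Fin w.length) :
    (appendEquiv v w (.inr i)).val = v.length + i := by
  simp [appendEquiv]

theorem get_appendEquiv_inl (i : Fin v.length) :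
    (v ++ w).get (appendEquiv v w (.inl i)) = v.get i := by
  simp [appendEquiv_inl_val, List.getElem_append_left]

theorem get_appendEquiv_inr (i : Fin w.length) :
    (v ++ w).get (appendEquiv v w (.inr i)) = w.get i := by
  simp [appendEquiv_inr_val, List.getElem_append_right]

theorem appendEquiv_lt_iff (a b : Fin v.length ⊕ Fin w.length) :
    appendEquiv v w a < appendEquiv v w b ↔ Sum.Lex (· < ·) (· < ·) a b := by
  rcases a with a | a <;> rcases b with b | b <;>
    simp only [Fin.lt_def, appendEquiv_inl_val, appendEquiv_inr_val, Sum.lex_inl_inl,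
      Sum.lex_inr_inr, Sum.Lex.sep, Sum.lex_inr_inl, iff_true, iff_false] <;> omega

end appendEquiv

/-! ### The composition theorem -/

namespace MSOFormula

variable {α : Type*}

/-- `φ.Splits s`: on a word `v ++ w`, with the first-order variables distributed between `v` and
`w` according to `s`, the formula `φ` is a finite disjunction of conjunctions of a property of `v`
and a formula evaluated in `w`. -/
def Splits {m n : ℕ} (φ : MSOFormula α m n) {p q : ℕ} (s : Fin m → Fin p ⊕ Fin q) : Prop :=
  ∃ (ι : Type) (_ : Fintype ι)
    (L : ι → (v : List α) → (Fin p → Fin v.length) → (Fin n → Set (Fin v.length)) → Prop)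
    (R : ι → MSOFormula α q n),
    ∀ (v w : List α) (x : Fin p → Fin v.length) (y : Fin q → Fin w.length)
      (X : Fin n → Set (Fin (v ++ w).length)),
      φ.Sat (v ++ w) (fun i => appendEquiv v w (Sum.map x y (s i))) X ↔
        ∃ i, L i v x (fun j => {a | appendEquiv v w (.inl a) ∈ X j}) ∧
          (R i).Sat w y (fun j => {a | appendEquiv v w (.inr a) ∈ X j})

section Splits

variable {m n p q : ℕ} {s : Fin m → Fin p ⊕ Fin q}

theorem splits_of_left {φ : MSOFormula α m n}
    (L : (v : List α) → (Fin p → Fin v.length) → (Fin n → Set (Fin v.length)) → Prop)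
    (h : ∀ (v w : List α) (x : Fin p → Fin v.length) (y : Fin q → Fin w.length)
      (X : Fin n → Set (Fin (v ++ w).length)),
      φ.Sat (v ++ w) (fun i => appendEquiv v w (Sum.map x y (s i))) X ↔
        L v x (fun j => {a | appendEquiv v w (.inl a) ∈ X j})) : φ.Splits s :=
  ⟨Unit, inferInstance, fun _ => L, fun _ => verum, fun v w x y X => by
    simp [h, sat_verum]⟩

theorem splits_of_right {φ : MSOFormula α m n} (R : MSOFormula α q n)
    (h : ∀ (v w : List α) (x : Fin p → Fin v.length) (y : Fin q → Fin w.length)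
      (X : Fin n → Set (Fin (v ++ w).length)),
      φ.Sat (v ++ w) (fun i => appendEquiv v w (Sum.map x y (s i))) X ↔
        R.Sat w y (fun j => {a | appendEquiv v w (.inr a) ∈ X j})) : φ.Splits s :=
  ⟨Unit, inferInstance, fun _ _ _ _ => True, fun _ => R, fun v w x y X => by simp [h]⟩

theorem Splits.neg {φ : MSOFormula α m n} (h : φ.Splits s) : φ.neg.Splits s := by
  classical
  obtain ⟨ι, _, L, R, h⟩ := h
  -- Distributivity: the disjunction fails iff, for some `S`, every `R i` with `i ∈ S` fails and
  -- every `L i` with `i ∉ S` fails.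
  refine ⟨Finset ι, inferInstance, fun S v x X => ∀ i ∉ S, ¬ L i v x X,
    fun S => finsetConj S fun i => (R i).neg, fun v w x y X => ?_⟩
  simp only [Sat, h, sat_finsetConj, not_exists, not_and]
  constructor
  · intro H
    refine ⟨univ.filter fun i => L i v x (fun j => {a | appendEquiv v w (.inl a) ∈ X j}), ?_, ?_⟩
    · intro i hi; simpa using hi
    · intro i hi; exact H i (by simpa using hi)
  · rintro ⟨S, h1, h2⟩ i hL
    exact h2 i (by_contra fun hi => h1 i hi hL)

theorem Splits.conj {φ ψ : MSOFormula α m n} (hφ : φ.Splits s) (hψ : ψ.Splits s) :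
    (φ.conj ψ).Splits s := by
  obtain ⟨ι, _, L, R, h⟩ := hφ
  obtain ⟨κ, _, L', R', h'⟩ := hψ
  refine ⟨ι × κ, inferInstance, fun i v x X => L i.1 v x X ∧ L' i.2 v x X,
    fun i => (R i.1).conj (R' i.2), fun v w x y X => ?_⟩
  simp only [Sat, h, h', Prod.exists]
  constructor
  · rintro ⟨⟨i, a, b⟩, j, c, d⟩
    exact ⟨i, j, ⟨a, c⟩, b, d⟩
  · rintro ⟨i, j, ⟨a, c⟩, b, d⟩
    exact ⟨⟨i, a, b⟩, j, c, d⟩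

/-- The quantified position lies in `v` or in `w`; each case extends `s` by one variable on that
side. -/
theorem Splits.exPos {φ : MSOFormula α (m + 1) n}
    (hL : φ.Splits (Fin.cons (.inl 0) fun i => Sum.map Fin.succ id (s i) :
      Fin (m + 1) → Fin (p + 1) ⊕ Fin q))
    (hR : φ.Splits (Fin.cons (.inr 0) fun i => Sum.map id Fin.succ (s i) :
      Fin (m + 1) → Fin p ⊕ Fin (q + 1))) :
    φ.exPos.Splits s := by
  obtain ⟨ι, _, L, R, h⟩ := hL
  obtain ⟨κ, _, L', R', h'⟩ := hR
  refine ⟨ι ⊕ κ, inferInstance,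
    Sum.elim (fun i v x X => ∃ a, L i v (Fin.cons a x) X) L',
    Sum.elim R fun i => (R' i).exPos, fun v w x y X => ?_⟩
  have eL (a : Fin v.length) :
      (Fin.cons (appendEquiv v w (.inl a))
        (fun i => appendEquiv v w (Sum.map x y (s i))) : Fin (m + 1) → _) =
      fun i => appendEquiv v w (Sum.map (Fin.cons a x : Fin (p + 1) → _) y
        ((Fin.cons (.inl 0) fun i => Sum.map Fin.succ id (s i) :
          Fin (m + 1) → Fin (p + 1) ⊕ Fin q) i)) := by
    funext i
    refine Fin.cases ?_ (fun i => ?_) i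
    · simp
    · simp only [Fin.cons_succ]
      cases s i <;> simp
  have eR (a : Fin w.length) :
      (Fin.cons (appendEquiv v w (.inr a))
        (fun i => appendEquiv v w (Sum.map x y (s i))) : Fin (m + 1) → _) =
      fun i => appendEquiv v w (Sum.map x (Fin.cons a y : Fin (q + 1) → _)
        ((Fin.cons (.inr 0) fun i => Sum.map id Fin.succ (s i) :
          Fin (m + 1) → Fin p ⊕ Fin (q + 1)) i)) := by
    funext i
    refine Fin.cases ?_ (fun i => ?_) i
    · simp
    · simp only [Fin.cons_succ]
      cases s i <;> simp
  simp only [Sat]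
  rw [← (appendEquiv v w).exists_congr_right]
  simp only [Sum.exists, eL, eR, h, h', Sum.elim_inl, Sum.elim_inr, Sat]
  refine or_congr ?_ ?_
  · constructor
    · rintro ⟨a, i, h1, h2⟩; exact ⟨i, ⟨a, h1⟩, h2⟩
    · rintro ⟨i, ⟨a, h1⟩, h2⟩; exact ⟨a, i, h1, h2⟩
  · constructor
    · rintro ⟨a, i, h1, h2⟩; exact ⟨i, h1, a, h2⟩
    · rintro ⟨i, h1, a, h2⟩; exact ⟨a, i, h1, h2⟩

theorem Splits.exSet {φ : MSOFormula α m (n + 1)} (h : φ.Splits s) : φ.exSet.Splits s := by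
  obtain ⟨ι, _, L, R, h⟩ := h
  refine ⟨ι, inferInstance, fun i v x X => ∃ A, L i v x (Fin.cons A X), fun i => (R i).exSet,
    fun v w x y X => ?_⟩
  have e {β : Type _} (g : β → Fin (v ++ w).length) (P : Set (Fin (v ++ w).length)) :
      (fun j => {a | g a ∈ (Fin.cons P X : Fin (n + 1) → Set (Fin (v ++ w).length)) j}) =
        (Fin.cons {a | g a ∈ P} fun j => {a | g a ∈ X j} : Fin (n + 1) → Set β) := by
    funext j
    refine Fin.cases ?_ (fun j => ?_) j <;> simp
  simp only [Sat, h]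
  constructor
  · rintro ⟨P, i, h1, h2⟩
    rw [e fun a => appendEquiv v w (.inl a)] at h1
    rw [e fun a => appendEquiv v w (.inr a)] at h2
    exact ⟨i, ⟨_, h1⟩, _, h2⟩
  · rintro ⟨i, ⟨A, h1⟩, B, h2⟩
    -- A set of positions of `v ++ w` is an arbitrary pair of sets, so the two witnesses can be
    -- glued.
    refine ⟨{c | Sum.elim (· ∈ A) (· ∈ B) ((appendEquiv v w).symm c)}, i, ?_, ?_⟩
    · rw [e fun a => appendEquiv v w (.inl a)]
      simpa using h1
    · rw [e fun a => appendEquiv v w (.inr a)]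
      simpa using h2

end Splits

/-- The composition theorem for MSO over words. -/
theorem splits {m n : ℕ} (φ : MSOFormula α m n) :
    ∀ {p q : ℕ} (s : Fin m → Fin p ⊕ Fin q), φ.Splits s := by
  induction φ with
  | letter a i =>
    intro p q s
    rcases hi : s i with j | j
    · exact splits_of_left (fun v x _ => v.get (x j) = a) fun v w x y X => by
        simp only [Sat, hi, Sum.map_inl, get_appendEquiv_inl]
    · exact splits_of_right (letter a j) fun v w x y X => by
        simp only [Sat, hi, Sum.map_inr, get_appendEquiv_inr]
  | lt i j =>
    intro p q s
    rcases hi : s i with a | a <;> rcases hj : s j with b | b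
    · exact splits_of_left (fun v x _ => x a < x b) fun v w x y X => by
        simp [Sat, hi, hj, appendEquiv_lt_iff]
    -- Positions of `v` precede those of `w`, so mixed comparisons are constant.
    · exact splits_of_left (fun v x _ => True) fun v w x y X => by
        simp [Sat, hi, hj, appendEquiv_lt_iff]
    · exact splits_of_left (fun v x _ => False) fun v w x y X => by
        simp [Sat, hi, hj, appendEquiv_lt_iff]
    · exact splits_of_right (lt a b) fun v w x y X => by
        simp [Sat, hi, hj, appendEquiv_lt_iff]
  | eq i j =>
    intro p q s
    rcases hi : s i with a | a <;> rcases hj : s j with b | b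
    · exact splits_of_left (fun v x _ => x a = x b) fun v w x y X => by simp [Sat, hi, hj]
    · exact splits_of_left (fun v x _ => False) fun v w x y X => by simp [Sat, hi, hj]
    · exact splits_of_left (fun v x _ => False) fun v w x y X => by simp [Sat, hi, hj]
    · exact splits_of_right (eq a b) fun v w x y X => by simp [Sat, hi, hj]
  | mem i j =>
    intro p q s
    rcases hi : s i with a | a
    · exact splits_of_left (fun v x X => x a ∈ X j) fun v w x y X => by simp [Sat, hi]
    · exact splits_of_right (mem a j) fun v w x y X => by simp [Sat, hi]
  | neg φ ih => exact fun s => (ih s).neg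
  | conj φ ψ ihφ ihψ => exact fun s => (ihφ s).conj (ihψ s)
  | exPos φ ih => exact fun s => (ih _).exPos (ih _)
  | exSet φ ih => exact fun s => (ih s).exSet

/-- For a fixed distribution of the variables, the number of satisfying valuations in `v ++ w` is
a finite sum of products of a function of `v` and a count in `w`. -/
theorem exists_card_eq_sum {m p q : ℕ} (φ : MSOFormula α m 0) (s : Fin m → Fin p ⊕ Fin q) :
    ∃ (ι : Type) (_ : Fintype ι)
      (L : ι → (v : List α) → (Fin p → Fin v.length) → Prop) (R : ι → MSOFormula α q 0),
      ∀ v w : List α,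
        Nat.card {z : (Fin p → Fin v.length) × (Fin q → Fin w.length) //
          φ.Sat (v ++ w) (fun i => appendEquiv v w (Sum.map z.1 z.2 (s i))) fun i => i.elim0} =
        ∑ i, Nat.card {x : Fin p → Fin v.length // L i v x} * (R i).count w := by
  classical
  obtain ⟨ι, _, L, R, h⟩ := φ.splits s
  -- Each `y` has exactly one truth set `T`, so indexing by `T` makes the disjunction disjoint and
  -- the counts add up.
  refine ⟨Finset ι, inferInstance, fun T v x => ∃ i ∈ T, L i v x fun i => i.elim0,
    truthSet R, fun v w => ?_⟩
  simp only [count, ← Nat.card_prod]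
  rw [← Nat.card_sigma]
  refine Nat.card_congr (Equiv.symm (Equiv.ofBijective (fun t => ⟨(t.2.1.1, t.2.2.1), ?_⟩) ?_))
  · rw [h]
    obtain ⟨T, ⟨x, i, hi, hx⟩, ⟨y, hy⟩⟩ := t
    rw [sat_truthSet] at hy
    refine ⟨i, ?_, ?_⟩
    · convert hx
    · convert (hy i).1 hi
  · constructor
    · rintro ⟨T, ⟨x, hx⟩, ⟨y, hy⟩⟩ ⟨T', ⟨x', hx'⟩, ⟨y', hy'⟩⟩ H
      simp only [Subtype.mk.injEq, Prod.mk.injEq] at H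
      obtain ⟨rfl, rfl⟩ := H
      obtain rfl : T = T' := by
        ext i
        rw [sat_truthSet] at hy hy'
        rw [hy, hy']
      rfl
    · rintro ⟨⟨x, y⟩, hz⟩
      obtain ⟨i, hL, hR⟩ := (h _ _ _ _ _).1 hz
      refine ⟨⟨univ.filter fun i => (R i).Sat w y fun i => i.elim0, ⟨x, i, ?_, ?_⟩, ⟨y, ?_⟩⟩, rfl⟩
      · simp only [mem_filter, mem_univ, true_and]
        convert hR
      · convert hL
      · simp [sat_truthSet]

end MSOFormula

/-! ### Counting on a concatenation -/

/-- Valuations in a disjoint union, sorted by the set `S` of variables sent to the left. -/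
theorem bijective_sumMap_finSumEquivOfFinset {m : ℕ} (A B : Type*) :
    Function.Bijective fun t : Σ S : Finset (Fin m), (Fin #S → A) × (Fin #Sᶜ → B) =>
      fun i : Fin m => Sum.map t.2.1 t.2.2 ((finSumEquivOfFinset rfl rfl).symm i) := by
  have key (S : Finset (Fin m)) (x : Fin #S → A) (y : Fin #Sᶜ → B) (i : Fin m) :
      i ∈ S ↔ (Sum.map x y ((finSumEquivOfFinset rfl rfl).symm i)).isLeft := by
    obtain ⟨j, rfl⟩ := (finSumEquivOfFinset (s := S) rfl rfl).surjective i
    rw [Equiv.symm_apply_apply]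
    rcases j with j | j
    · simp
    · have := mem_compl.1 (orderEmbOfFin_mem Sᶜ rfl j)
      simpa only [finSumEquivOfFinset_inr, Sum.map_inr, Sum.isLeft_inr, Bool.false_eq_true,
        iff_false] using this
  constructor
  · rintro ⟨S, x, y⟩ ⟨S', x', y'⟩ H
    obtain rfl : S = S' := by
      ext i
      rw [key S x y, key S' x' y']
      exact iff_of_eq (congrArg (fun z => (z.isLeft : Prop)) (congrFun H i))
    have H' (j) : Sum.map x y j = Sum.map x' y' j := by
      simpa using congrFun H (finSumEquivOfFinset rfl rfl j)
    obtain rfl : x = x' := funext fun j => by simpa using H' (.inl j)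
    obtain rfl : y = y' := funext fun j => by simpa using H' (.inr j)
    rfl
  · intro z
    let S : Finset (Fin m) := univ.filter fun i => (z i).isLeft
    let e : Fin #S ⊕ Fin #Sᶜ ≃ Fin m := finSumEquivOfFinset rfl rfl
    have hl (j : Fin #S) : ∃ a, z (e (.inl j)) = .inl a := by
      have := orderEmbOfFin_mem S rfl j
      rw [mem_filter] at this
      exact Sum.isLeft_iff.1 this.2
    have hr (j : Fin #Sᶜ) : ∃ b, z (e (.inr j)) = .inr b := by
      have := orderEmbOfFin_mem Sᶜ rfl j
      rw [mem_compl, mem_filter, not_and, Sum.not_isLeft] at this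
      exact Sum.isRight_iff.1 (this (mem_univ _))
    choose x hx using hl
    choose y hy using hr
    refine ⟨⟨S, x, y⟩, funext fun i => ?_⟩
    obtain ⟨j, rfl⟩ := e.surjective i
    change Sum.map x y (e.symm (e j)) = _
    rw [Equiv.symm_apply_apply]
    rcases j with j | j
    · simp [hx]
    · simp [hy]

/-- The count of a formula on `v ++ w` is a finite sum of products of a function of `v` and the
count of a formula on `w`; the function of `v` is bounded if no variable is left to it. -/
theorem MSOFormula.exists_count_append {α : Type*} {m : ℕ} (φ : MSOFormula α m 0) :
    ∃ (ι : Type) (_ : Fintype ι) (q : ι → ℕ) (a : ι → List α → ℕ)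
      (R : (i : ι) → MSOFormula α (q i) 0),
      (∀ i, q i ≤ m) ∧ (∀ i, q i = m → ∀ v, a i v ≤ 1) ∧
      ∀ v w : List α, φ.count (v ++ w) = ∑ i, a i v * (R i).count w := by
  choose ι hι L R h using fun S : Finset (Fin m) =>
    φ.exists_card_eq_sum ((finSumEquivOfFinset (s := S) rfl rfl).symm : Fin m → Fin #S ⊕ Fin #Sᶜ)
  refine ⟨Σ S, ι S, inferInstance, fun i => #i.1ᶜ,
    fun i v => Nat.card {x : Fin #i.1 → Fin v.length // L i.1 i.2 v x}, fun i => R i.1 i.2,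
    fun i => ?_, fun i hi v => ?_, fun v w => ?_⟩
  · simpa using card_le_univ i.1ᶜ
  -- If `w` receives all `m` variables, only the empty valuation remains on `v`.
  · have h0 : #i.1 = 0 := by
      have := card_add_card_compl i.1
      rw [Fintype.card_fin] at this
      change #i.1ᶜ = m at hi
      omega
    have : IsEmpty (Fin #i.1) := by rw [h0]; infer_instance
    exact Finite.card_le_one_iff_subsingleton.2 inferInstance
  · rw [Fintype.sum_sigma]
    simp only [← h]
    rw [← Nat.card_sigma, count]
    let e := Equiv.ofBijective _ (bijective_sumMap_finSumEquivOfFinset (m := m)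
      (Fin v.length) (Fin w.length))
    let e' := e.trans ((Equiv.refl (Fin m)).arrowCongr (appendEquiv v w))
    refine Nat.card_congr (Equiv.symm (.trans ?_ (e'.subtypeEquiv
      (p := fun t => φ.Sat (v ++ w) (e' t) fun i => i.elim0) fun _ => Iff.rfl)))
    exact ⟨fun t => ⟨⟨t.1, t.2.1⟩, t.2.2⟩, fun t => ⟨t.1.1, t.1.2, t.2⟩, fun _ => rfl,
      fun _ => rfl⟩

/-! ### Polyregular functions and the quasi-order -/

section Polyregular

variable {α : Type*}

theorem isPolyregular_sum {ι : Type*} [Fintype ι] {S : Type*} [CommSemiring S] {k : ℤ}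
    (m : ι → ℕ) (φ : (i : ι) → MSOFormula α (m i) 0) (c : ι → S) (hm : ∀ i, (m i : ℤ) ≤ k) :
    IsPolyregular S k fun w => ∑ i, c i * ((φ i).count w : S) := by
  let e := Fintype.equivFin ι
  exact ⟨Fintype.card ι, fun j => m (e.symm j), fun j => φ (e.symm j), fun j => c (e.symm j),
    fun j => hm _, fun w => (e.symm.sum_comp fun i => c i * ((φ i).count w : S)).symm⟩

theorem IsPolyregular.add {S : Type*} [CommSemiring S] {k : ℤ} {f g : List α → S}
    (hf : IsPolyregular S k f) (hg : IsPolyregular S k g) : IsPolyregular S k (f + g) := by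
  obtain ⟨r, m, φ, c, hm, h⟩ := hf
  obtain ⟨r', m', φ', c', hm', h'⟩ := hg
  have := isPolyregular_sum (k := k) (Sum.elim m m')
    (fun i => Sum.rec (motive := fun i => MSOFormula α (Sum.elim m m' i) 0) φ φ' i) (Sum.elim c c')
    (by rintro (i | i); exacts [hm i, hm' i])
  convert this using 1
  funext w
  simp [h, h']

theorem NPoly.zero_mem (k : ℤ) : (0 : List α → ℤ) ∈ NPoly α k :=
  ⟨0, ⟨0, Fin.elim0, fun i => i.elim0, Fin.elim0, fun i => i.elim0, by simp⟩, by simp⟩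

theorem NPoly.add_mem {k : ℤ} {f g : List α → ℤ} (hf : f ∈ NPoly α k) (hg : g ∈ NPoly α k) :
    f + g ∈ NPoly α k := by
  obtain ⟨f', hf', h⟩ := hf
  obtain ⟨g', hg', h'⟩ := hg
  exact ⟨f' + g', hf'.add hg', fun w => by simp [h, h']⟩

theorem resLE_refl (f : List α → ℤ) (k : ℕ) (u : List α) : ResLE f k u u := by
  simpa [ResLE, noncommDeriv] using NPoly.zero_mem _

theorem ResLE.trans {f : List α → ℤ} {k : ℕ} {u v w : List α} (h : ResLE f k u v)
    (h' : ResLE f k v w) : ResLE f k u w := by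
  have := NPoly.add_mem h' h
  rwa [noncommDeriv, noncommDeriv, sub_add_sub_cancel] at this

/-- A polyregular function evaluated at `v ++ w` is a finite sum of products of a function of `v`
and the count of a formula on `w`; the function of `v` is bounded if the formula has `k` free
variables. -/
theorem IsPolyregular.exists_append {k : ℕ} {g : List α → ℕ} (hg : IsPolyregular ℕ k g) :
    ∃ (ι : Type) (_ : Fintype ι) (q : ι → ℕ) (a : ι → List α → ℕ)
      (R : (i : ι) → MSOFormula α (q i) 0) (B : ι → ℕ),
      (∀ i, q i ≤ k) ∧ (∀ i, q i = k → ∀ v, a i v ≤ B i) ∧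
      ∀ v w : List α, g (v ++ w) = ∑ i, a i v * (R i).count w := by
  obtain ⟨r, m, φ, c, hm, h⟩ := hg
  choose ι hι q a R hq ha hR using fun i => (φ i).exists_count_append
  have hm' (i) : m i ≤ k := by exact_mod_cast hm i
  refine ⟨Σ i, ι i, inferInstance, fun j => q j.1 j.2, fun j v => c j.1 * a j.1 j.2 v,
    fun j => R j.1 j.2, fun j => c j.1, fun j => (hq _ _).trans (hm' _), fun j hj v => ?_,
    fun v w => ?_⟩
  · have := ha j.1 j.2 (le_antisymm (hq _ _) ((hm' _).trans_eq hj.symm)) v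
    exact (Nat.mul_le_mul_left _ this).trans_eq (mul_one _)
  · simp only [h, hR, Fintype.sum_sigma, mul_sum, Nat.cast_id, mul_assoc]

theorem wellQuasiOrdered_resLE {k : ℕ} {f : List α → ℤ} (hf : f ∈ NPoly α k) :
    WellQuasiOrdered (ResLE f k) := by
  obtain ⟨g, hg, hfg⟩ := hf
  obtain ⟨ι, _, q, a, R, B, hq, hB, h⟩ := hg.exists_append
  intro u
  -- Dickson's lemma; the second component reverses the order on the bounded coefficients.
  obtain ⟨i, j, hij, hle⟩ := wellQuasiOrdered_le fun n : ℕ =>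
    ((fun t => a t (u n), fun t => if q t = k then B t - a t (u n) else 0) : (ι → ℕ) × (ι → ℕ))
  obtain ⟨hle, hle'⟩ := hle
  have heq (t) (ht : q t = k) : a t (u i) = a t (u j) := by
    have h1 := hle t
    have h2 := hle' t
    simp only [ht, if_true] at h1 h2
    have := hB t ht (u i)
    have := hB t ht (u j)
    omega
  refine ⟨i, j, hij, fun w => ∑ t : {t // q t < k}, (a t (u j) - a t (u i)) * (R t).count w,
    isPolyregular_sum (fun t : {t // q t < k} => q t) (fun t => R t)
      (fun t => a t (u j) - a t (u i)) (fun t => ?_), fun w => ?_⟩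
  · have := t.2
    omega
  -- The terms with `q t = k` vanish by `heq`, so the sum extends to all `t`.
  · have hs : ∑ t : {t // q t < k}, (a t (u j) - a t (u i)) * (R t).count w =
        ∑ t, (a t (u j) - a t (u i)) * (R t).count w := by
      rw [← sum_subtype (univ.filter fun t => q t < k) (by simp)
        fun t => (a t (u j) - a t (u i)) * (R t).count w]
      refine sum_filter_of_ne fun t _ ht => lt_of_le_of_ne (hq t) fun hk => ht ?_
      simp [heq t hk]
    beta_reduce
    rw [hs]
    simp only [noncommDeriv, wordResidual, Pi.sub_apply, hfg, h]
    push_cast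
    rw [← sum_sub_distrib]
    refine sum_congr rfl fun t _ => ?_
    rw [Nat.cast_sub (hle t), sub_mul]

end Polyregular

theorem mainTheorem2 {α : Type*} [Finite α] (k : ℕ) (f : List α → ℤ)
    (hf : f ∈ NPoly α (k : ℤ)) :
    IsPreorder (List α) (ResLE f k) ∧ WellQuasiOrdered (ResLE f k) :=
  ⟨{ refl := resLE_refl f k, trans := fun _ _ _ => ResLE.trans }, wellQuasiOrdered_resLE hf⟩
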